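/- Let $k$ be an algebraically closed field of characteristic zero, let $n \geq 0$, and let $\mathbb{X}$ be a nonempty finite set of points in $\mathbb{P}^1\times\mathbb{P}^n$ over $k$. Let $R=k[x_0,x_1,y_0,\ldots,y_n]$ be the bigraded coordinate ring of $\mathbb{P}^1\times\mathbb{P}^n$, with $\deg x_i=(1,0)$ and $\deg y_j=(0,1)$, and let $I_{\mathbb{X}}\subseteq R$ be the ideal generated by all bihomogeneous forms that vanish at every point of $\mathbb{X}$. Suppose that $\mathbb{X}$ satisfies property $(\star)$: whenever $P_1\times Q_1$ and $P_2\times Q_2$ are in $\mathbb{X}$ with $P_1\neq P_2$ and $Q_1\neq Q_2$, at least one of $P_1\times Q_2$ and $P_2\times Q_1$ is in $\mathbb{X}$. Then $\mathbb{X}$ is arithmetically Cohen-Macaulay (ACM), that is, $$\dim R/I_{\mathbb{X}}=\operatorname{depth} R/I_{\mathbb{X}}=2,$$ where $\dim$ is the Krull dimension and $\operatorname{depth}$ is the maximal length of an $R/I_{\mathbb{X}}$-regular sequence of elements of the ideal $(x_0,x_1,y_0,\ldots,y_n)$. -/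

import Mathlib

open scoped LinearAlgebra.Projectivization

/-- Projective space `ℙ^n` over `k`: the lines through the origin of `k^(n+1)`. -/
abbrev ProjSpace (k : Type*) [Field k] (n : ℕ) : Type _ := ℙ k (Fin (n + 1) → k)

/-- The coordinate ring `k[x_0, …, x_m, y_0, …, y_n]` of `ℙ^m × ℙ^n`;
`Sum.inl i` is the index of `x_i` and `Sum.inr j` is the index of `y_j`. -/
abbrev BiCoordRing (k : Type*) [Field k] (m n : ℕ) : Type _ :=
  MvPolynomial (Fin (m + 1) ⊕ Fin (n + 1)) k

/-- The bigrading: `deg x_i = (1, 0)` and `deg y_j = (0, 1)`. -/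
def biWeight (m n : ℕ) : Fin (m + 1) ⊕ Fin (n + 1) → ℕ × ℕ :=
  Sum.elim (fun _ => (1, 0)) (fun _ => (0, 1))

/-- `F` is a bihomogeneous form (of some bidegree `d`). -/
def IsBihomogeneous {k : Type*} [Field k] {m n : ℕ} (F : BiCoordRing k m n) : Prop :=
  ∃ d : ℕ × ℕ, MvPolynomial.IsWeightedHomogeneous (biWeight m n) F d

/-- `F` vanishes at the point `p = P × Q`: it is zero at all pairs of homogeneous coordinate
vectors of `P` and `Q`. -/
def VanishesAt {k : Type*} [Field k] {m n : ℕ} (F : BiCoordRing k m n)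
    (p : ProjSpace k m × ProjSpace k n) : Prop :=
  ∀ (a : Fin (m + 1) → k) (b : Fin (n + 1) → k) (ha : a ≠ 0) (hb : b ≠ 0),
    Projectivization.mk k a ha = p.1 → Projectivization.mk k b hb = p.2 →
      MvPolynomial.eval (Sum.elim a b) F = 0

/-- The defining ideal `I_X` of a set of points `X ⊆ ℙ^m × ℙ^n`: the ideal generated by all
bihomogeneous forms that vanish at every point of `X`. -/
noncomputable def pointsIdeal {k : Type*} [Field k] {m n : ℕ} (X : Set (ProjSpace k m × ProjSpace k n)) :
    Ideal (BiCoordRing k m n) :=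
  Ideal.span {F | IsBihomogeneous F ∧ ∀ p ∈ X, VanishesAt F p}

/-- The ideal `(x_0, …, x_m, y_0, …, y_n)` of the coordinate ring. -/
noncomputable def irrelevantIdeal (k : Type*) [Field k] (m n : ℕ) : Ideal (BiCoordRing k m n) :=
  Ideal.span (Set.range MvPolynomial.X)

/-- The depth of an `A`-module `M` with respect to an ideal `J`: the supremum of the lengths of
`M`-regular sequences of elements of `J`. -/
noncomputable def depthIn {A : Type*} [CommRing A] (J : Ideal A) (M : Type*) [AddCommGroup M]
    [Module A M] : ℕ∞ :=
  ⨆ (rs : List A) (_ : (∀ r ∈ rs, r ∈ J) ∧ RingTheory.Sequence.IsRegular M rs), (rs.length : ℕ∞)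

/-- `X ⊆ ℙ^m × ℙ^n` is arithmetically Cohen-Macaulay: its coordinate ring `R / I_X` has
Krull dimension and depth both equal to `2`, the number of projective factors. Depth is that of
the graded ring `R / I_X`, i.e. with respect to the ideal generated by all the variables. -/
def IsACM {k : Type*} [Field k] {m n : ℕ} (X : Set (ProjSpace k m × ProjSpace k n)) : Prop :=
  ringKrullDim (BiCoordRing k m n ⧸ pointsIdeal X) = 2 ∧
    depthIn (irrelevantIdeal k m n) (BiCoordRing k m n ⧸ pointsIdeal X) = 2

/-- Property `(⋆)`. -/
def PropertyStar {k : Type*} [Field k] {m n : ℕ} (X : Set (ProjSpace k m × ProjSpace k n)) :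
    Prop :=
  ∀ (P₁ P₂ : ProjSpace k m) (Q₁ Q₂ : ProjSpace k n), (P₁, Q₁) ∈ X → (P₂, Q₂) ∈ X →
    P₁ ≠ P₂ → Q₁ ≠ Q₂ → (P₁, Q₂) ∈ X ∨ (P₂, Q₁) ∈ X

/-! `I_X` is the intersection of the kernels of the maps `coneHom`, which restrict a polynomial to
the product of the lines over a point of `X`. Let `x` be the linear form on `ℙ^1` vanishing only at
a point `c` that is not a first coordinate of `X`, and `y` a linear form in the `y_j` vanishing at
no second coordinate. Then `x` is regular modulo `I_X`, and the work is to show that `y` is regular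
modulo `I_X + (x)`. Modulo `x` the ring is `k[y][T]`. The image of `I_X` there consists of the `∑
f_i T^i` such that `f_i` vanishes at every `Q` whose fiber in `X` has more than `i` points, and this
condition survives cancelling `y`. Its necessity (`lineHom_coeff_fiberHom_eq_zero`) holds for every
finite `X`; its sufficiency (`exists_mem_pointsIdeal_fiberHom_eq`) uses `(⋆)`, which makes the
fibers a chain under inclusion. Each kernel has quotient `k[T, t]`, so the dimension is at most 2;
the pair `x, y` gives the reverse bound, and no regular sequence is longer than the dimension. -/

/-! ### Restriction to lines and to products of lines. -/

section Hom

variable {k : Type*} [Field k]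

/-- Restriction to the line through `a` in the first set of variables:
`x_i ↦ a_i T` and `y_j ↦ y_j`. -/
noncomputable def fiberHom {m : ℕ} (ι : Type*) (a : Fin (m + 1) → k) :
    MvPolynomial (Fin (m + 1) ⊕ ι) k →ₐ[k] Polynomial (MvPolynomial ι k) :=
  MvPolynomial.aeval (Sum.elim (fun i => Polynomial.C (MvPolynomial.C (a i)) * Polynomial.X)
    (fun j => Polynomial.C (MvPolynomial.X j)))

/-- Restriction to the line through `b`: `y_j ↦ b_j t`. -/
noncomputable def lineHom {n : ℕ} (b : Fin (n + 1) → k) :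
    MvPolynomial (Fin (n + 1)) k →ₐ[k] MvPolynomial Unit k :=
  MvPolynomial.aeval (fun j => MvPolynomial.C (b j) * MvPolynomial.X ())

/-- Restriction to the line through `b` in the second set of variables:
`x_i ↦ x_i` and `y_j ↦ b_j t`. -/
noncomputable def sndLineHom (m : ℕ) {n : ℕ} (b : Fin (n + 1) → k) :
    BiCoordRing k m n →ₐ[k] MvPolynomial (Fin (m + 1) ⊕ Unit) k :=
  MvPolynomial.aeval (Sum.elim (fun i => MvPolynomial.X (Sum.inl i))
    (fun j => MvPolynomial.C (b j) * MvPolynomial.X (Sum.inr ())))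

/-- Restriction to the product of the lines through `a` and `b`:
`x_i ↦ a_i T` and `y_j ↦ b_j t`. -/
noncomputable def coneHom {m n : ℕ} (a : Fin (m + 1) → k) (b : Fin (n + 1) → k) :
    BiCoordRing k m n →ₐ[k] Polynomial (MvPolynomial Unit k) :=
  (Polynomial.mapAlgHom (lineHom b)).comp (fiberHom _ a)

variable {m n : ℕ} (a : Fin (m + 1) → k) (b : Fin (n + 1) → k)

@[simp] lemma fiberHom_X_inl {ι : Type*} (i : Fin (m + 1)) :
    fiberHom ι a (MvPolynomial.X (Sum.inl i)) =
      Polynomial.C (MvPolynomial.C (a i)) * Polynomial.X := by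
  simp [fiberHom]

@[simp] lemma fiberHom_X_inr {ι : Type*} (j : ι) :
    fiberHom ι a (MvPolynomial.X (Sum.inr j)) = Polynomial.C (MvPolynomial.X j) := by
  simp [fiberHom]

@[simp] lemma fiberHom_C {ι : Type*} (r : k) :
    fiberHom ι a (MvPolynomial.C r) = Polynomial.C (MvPolynomial.C r) :=
  (fiberHom ι a).commutes r

lemma fiberHom_rename_inr {ι : Type*} (g : MvPolynomial ι k) :
    fiberHom ι a (MvPolynomial.rename Sum.inr g) = Polynomial.C g := by
  have : (fiberHom ι a).comp (MvPolynomial.rename Sum.inr) =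
      Algebra.algHom k (MvPolynomial ι k) (Polynomial (MvPolynomial ι k)) := by
    refine MvPolynomial.algHom_ext fun j => ?_
    simp only [AlgHom.comp_apply, MvPolynomial.rename_X, fiberHom_X_inr]
    rfl
  exact DFunLike.congr_fun this g

@[simp] lemma lineHom_X (j : Fin (n + 1)) :
    lineHom b (MvPolynomial.X j) = MvPolynomial.C (b j) * MvPolynomial.X () := by
  simp [lineHom]

@[simp] lemma lineHom_C (r : k) : lineHom b (MvPolynomial.C r) = MvPolynomial.C r :=
  (lineHom b).commutes r

lemma coneHom_apply (F : BiCoordRing k m n) :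
    coneHom a b F = (fiberHom _ a F).map (lineHom b : _ →+* _) := rfl

lemma coeff_coneHom_eq_lineHom (F : BiCoordRing k m n) (i : ℕ) :
    (coneHom a b F).coeff i = lineHom b ((fiberHom _ a F).coeff i) := by
  simp [coneHom_apply]

lemma fiberHom_sndLineHom (F : BiCoordRing k m n) :
    fiberHom Unit a (sndLineHom m b F) = coneHom a b F := by
  have : (fiberHom Unit a).comp (sndLineHom m b) = coneHom a b := by
    refine MvPolynomial.algHom_ext fun i => ?_
    rcases i with i | j <;> simp [sndLineHom, coneHom]
  exact DFunLike.congr_fun this F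

lemma weight_biWeight (d : Fin (m + 1) ⊕ Fin (n + 1) →₀ ℕ) :
    Finsupp.weight (biWeight m n) d = (∑ i, d (Sum.inl i), ∑ j, d (Sum.inr j)) := by
  rw [Finsupp.weight_apply, Finsupp.sum_fintype _ _ (by simp), Fintype.sum_sum_type]
  simp [biWeight, Prod.ext_iff, Prod.fst_sum, Prod.snd_sum]

lemma coneHom_monomial (d : Fin (m + 1) ⊕ Fin (n + 1) →₀ ℕ) (r : k) :
    coneHom a b (MvPolynomial.monomial d r) =
      Polynomial.monomial (Finsupp.weight (biWeight m n) d).1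
        (MvPolynomial.monomial (Finsupp.single () (Finsupp.weight (biWeight m n) d).2)
          (MvPolynomial.eval (Sum.elim a b) (MvPolynomial.monomial d r))) := by
  rw [weight_biWeight, MvPolynomial.monomial_eq, Finsupp.prod_fintype _ _ (by simp),
    Fintype.prod_sum_type]
  simp only [coneHom, AlgHom.comp_apply, map_mul, map_prod, map_pow, fiberHom_X_inl,
    fiberHom_X_inr, fiberHom_C, Polynomial.coe_mapAlgHom, Polynomial.map_C,
    Polynomial.map_X, RingHom.coe_coe, lineHom_C, lineHom_X, mul_pow, Finset.prod_mul_distrib,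
    MvPolynomial.eval_C, MvPolynomial.eval_X, Sum.elim_inl, Sum.elim_inr,
    Finset.prod_pow_eq_pow_sum]
  rw [← Polynomial.C_mul_X_pow_eq_monomial, MvPolynomial.monomial_eq]
  simp only [map_mul, map_prod, map_pow, Finsupp.prod_single_index, pow_zero]
  ring

/-- The exponents of `T` and `t` separate the bidegrees, so `coneHom` sees the value of each
bihomogeneous component at `(a, b)` separately. -/
lemma coeff_coneHom (F : BiCoordRing k m n) (d e : ℕ) :
    ((coneHom a b F).coeff d).coeff (Finsupp.single () e) =
      MvPolynomial.eval (Sum.elim a b)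
        (MvPolynomial.weightedHomogeneousComponent (biWeight m n) (d, e) F) := by
  classical
  induction F using MvPolynomial.induction_on' with
  | add p q hp hq => simp only [map_add, Polynomial.coeff_add, MvPolynomial.coeff_add, hp, hq]
  | monomial u r =>
    rw [coneHom_monomial, MvPolynomial.weightedHomogeneousComponent_of_mem
      (MvPolynomial.isWeightedHomogeneous_monomial (biWeight m n) u r rfl), Polynomial.coeff_monomial]
    generalize Finsupp.weight (biWeight m n) u = w
    obtain ⟨w₁, w₂⟩ := w
    by_cases h₁ : w₁ = d
    · by_cases h₂ : w₂ = e
      · simp [h₁, h₂]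
      · simp [h₁, h₂, Ne.symm h₂, MvPolynomial.coeff_monomial]
    · simp [h₁, Ne.symm h₁]

lemma coneHom_eq_zero_iff (F : BiCoordRing k m n) :
    coneHom a b F = 0 ↔ ∀ d, MvPolynomial.eval (Sum.elim a b)
      (MvPolynomial.weightedHomogeneousComponent (biWeight m n) d F) = 0 := by
  constructor
  · rintro h ⟨d, e⟩
    rw [← coeff_coneHom, h]; simp
  · intro h
    ext d e
    obtain ⟨e, rfl⟩ : ∃ e' : ℕ, e = Finsupp.single () e' := ⟨e (), by ext; simp⟩
    rw [coeff_coneHom, h]; simp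

/-- Rescaling is the substitution `T ↦ uT`, `t ↦ vt`. The scalars may be zero, which later isolates
the constant term. -/
lemma coneHom_smul_smul_eq_zero (u v : k) {F : BiCoordRing k m n} (h : coneHom a b F = 0) :
    coneHom (u • a) (v • b) F = 0 := by
  have : coneHom (u • a) (v • b) =
      ((Polynomial.aeval (R := MvPolynomial Unit k)
          (Polynomial.C (MvPolynomial.C u) * Polynomial.X)).restrictScalars k).comp
        ((Polynomial.mapAlgHom
          (MvPolynomial.aeval fun j => MvPolynomial.C v * MvPolynomial.X j)).comp
          (coneHom a b)) := by
    refine MvPolynomial.algHom_ext fun i => ?_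
    rcases i with i | j
    · simp [coneHom]; ring
    · simp [coneHom, MvPolynomial.algebraMap_eq]; ring
  rw [this]
  simp [h]

lemma coneHom_eq_zero_of_mk_eq {a a' : Fin (m + 1) → k} {b b' : Fin (n + 1) → k}
    (ha : a ≠ 0) (ha' : a' ≠ 0) (hb : b ≠ 0) (hb' : b' ≠ 0)
    (hab : Projectivization.mk k a ha = Projectivization.mk k a' ha')
    (hbb : Projectivization.mk k b hb = Projectivization.mk k b' hb')
    {F : BiCoordRing k m n} (h : coneHom a' b' F = 0) : coneHom a b F = 0 := by
  obtain ⟨u, rfl⟩ := (Projectivization.mk_eq_mk_iff' k _ _ ha ha').1 hab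
  obtain ⟨v, rfl⟩ := (Projectivization.mk_eq_mk_iff' k _ _ hb hb').1 hbb
  exact coneHom_smul_smul_eq_zero _ _ u v h

end Hom

/-! ### The ideal of `X` as an intersection of kernels. -/

section PointsIdeal

variable {k : Type*} [Field k] {m n : ℕ}

lemma mem_pointsIdeal_iff {X : Set (ProjSpace k m × ProjSpace k n)} {F : BiCoordRing k m n} :
    F ∈ pointsIdeal X ↔ ∀ p ∈ X, coneHom p.1.rep p.2.rep F = 0 := by
  classical
  constructor
  · intro hF p hp
    suffices pointsIdeal X ≤ RingHom.ker (coneHom p.1.rep p.2.rep : _ →ₐ[k] _) from this hF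
    refine Ideal.span_le.2 ?_
    rintro G ⟨⟨d, hG⟩, hX⟩
    refine (coneHom_eq_zero_iff _ _ _).2 fun e => ?_
    rw [MvPolynomial.weightedHomogeneousComponent_of_mem hG]
    split_ifs
    · exact hX p hp _ _ p.1.rep_nonzero p.2.rep_nonzero p.1.mk_rep p.2.mk_rep
    · simp
  · intro h
    rw [← MvPolynomial.sum_weightedHomogeneousComponent (biWeight m n) F, finsum_eq_sum _
      (MvPolynomial.weightedHomogeneousComponent_finsupp F)]
    refine Ideal.sum_mem _ fun d _ => Ideal.subset_span
      ⟨⟨d, MvPolynomial.weightedHomogeneousComponent_isWeightedHomogeneous d F⟩, ?_⟩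
    intro p hp a b ha hb hpa hpb
    refine (coneHom_eq_zero_iff a b F).1 (coneHom_eq_zero_of_mk_eq ha p.1.rep_nonzero hb
      p.2.rep_nonzero ?_ ?_ (h p hp)) d
    · rw [hpa, p.1.mk_rep]
    · rw [hpb, p.2.mk_rep]

end PointsIdeal

/-! ### Linear forms on `ℙ^1` and reduction modulo one of them. -/

section LinearForm

variable {k : Type*} [Field k] {ι : Type*}

/-- The linear form `a_1 x_0 - a_0 x_1`, whose zero locus in `ℙ^1` is the point `[a_0 : a_1]`. -/
noncomputable def pointForm (ι : Type*) (a : Fin 2 → k) : MvPolynomial (Fin 2 ⊕ ι) k :=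
  MvPolynomial.C (a 1) * MvPolynomial.X (Sum.inl 0) -
    MvPolynomial.C (a 0) * MvPolynomial.X (Sum.inl 1)

lemma fiberHom_pointForm (c a : Fin 2 → k) :
    fiberHom ι c (pointForm ι a) =
      Polynomial.C (MvPolynomial.C (a 1 * c 0 - a 0 * c 1)) * Polynomial.X := by
  simp only [pointForm, map_sub, map_mul, fiberHom_C, fiberHom_X_inl]
  ring

lemma fiberHom_pointForm_self (c : Fin 2 → k) : fiberHom ι c (pointForm ι c) = 0 := by
  rw [fiberHom_pointForm, mul_comm (c 1), sub_self]; simp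

lemma mk_eq_mk_of_det_eq_zero {a c : Fin 2 → k} (ha : a ≠ 0) (hc : c ≠ 0)
    (h : a 1 * c 0 - a 0 * c 1 = 0) :
    Projectivization.mk k a ha = Projectivization.mk k c hc := by
  rw [Projectivization.mk_eq_mk_iff']
  by_cases h0 : c 0 = 0
  · have h1 : c 1 ≠ 0 := fun h1 => hc (by ext i; fin_cases i <;> simp [h0, h1])
    have : a 0 = 0 := by simpa [h0, h1] using h
    refine ⟨a 1 / c 1, ?_⟩
    ext i; fin_cases i <;> simp [h0, h1, this]
  · refine ⟨a 0 / c 0, ?_⟩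
    ext i; fin_cases i
    · simp [h0]
    · simp only [Pi.smul_apply, smul_eq_mul, Fin.mk_one]
      field_simp
      linear_combination -h

lemma det_rep_ne_zero {P : ProjSpace k 1} {c : Fin 2 → k} (hc : c ≠ 0)
    (h : P ≠ Projectivization.mk k c hc) : P.rep 1 * c 0 - P.rep 0 * c 1 ≠ 0 := fun h0 =>
  h (by rw [← P.mk_rep]; exact mk_eq_mk_of_det_eq_zero P.rep_nonzero hc h0)

lemma exists_section (ι : Type*) {c : Fin 2 → k} (hc : c ≠ 0) :
    ∃ σ : Polynomial (MvPolynomial ι k) →ₐ[k] MvPolynomial (Fin 2 ⊕ ι) k,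
      (fiberHom ι c (σ Polynomial.X) = Polynomial.X) ∧
      ∀ F, F - σ (fiberHom ι c F) ∈ Ideal.span {pointForm ι c} := by
  -- The linear form with coefficients `d` takes the value 1 at `c`, so it restricts to `T`.
  obtain ⟨d, hd⟩ : ∃ d : Fin 2 → k, d 0 * c 0 + d 1 * c 1 = 1 := by
    by_cases h0 : c 0 = 0
    · have h1 : c 1 ≠ 0 := fun h1 => hc (by ext i; fin_cases i <;> simp [h0, h1])
      exact ⟨![0, (c 1)⁻¹], by simp [h1]⟩
    · exact ⟨![(c 0)⁻¹, 0], by simp [h0]⟩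
  set l : MvPolynomial (Fin 2 ⊕ ι) k := MvPolynomial.C (d 0) * MvPolynomial.X (Sum.inl 0) +
    MvPolynomial.C (d 1) * MvPolynomial.X (Sum.inl 1) with hl
  let σ : Polynomial (MvPolynomial ι k) →ₐ[k] MvPolynomial (Fin 2 ⊕ ι) k :=
    { Polynomial.eval₂RingHom (MvPolynomial.rename Sum.inr : _ →ₐ[k] _).toRingHom l with
      commutes' := fun r => by
        simp [IsScalarTower.algebraMap_apply k (MvPolynomial ι k) (Polynomial (MvPolynomial ι k)),
          MvPolynomial.algebraMap_eq] }
  have hσX : σ Polynomial.X = l := Polynomial.eval₂_X _ _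
  have hσC : ∀ g, σ (Polynomial.C g) = MvPolynomial.rename Sum.inr g :=
    fun g => Polynomial.eval₂_C _ _
  have hdC : MvPolynomial.C (d 0) * MvPolynomial.C (c 0) +
      MvPolynomial.C (d 1) * MvPolynomial.C (c 1) = (1 : MvPolynomial (Fin 2 ⊕ ι) k) := by
    rw [← map_mul, ← map_mul, ← map_add, hd, map_one]
  refine ⟨σ, ?_, fun F => ?_⟩
  · rw [hσX, hl]
    simp only [map_add, map_mul, fiberHom_C, fiberHom_X_inl]
    rw [← mul_assoc, ← mul_assoc, ← add_mul, ← map_mul, ← map_mul, ← map_mul, ← map_mul,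
      ← map_add, ← map_add, hd, map_one, map_one, one_mul]
  · have : (Ideal.Quotient.mkₐ k (Ideal.span {pointForm ι c})) =
        (Ideal.Quotient.mkₐ k (Ideal.span {pointForm ι c})).comp (σ.comp (fiberHom ι c)) := by
      refine MvPolynomial.algHom_ext fun i => ?_
      simp only [AlgHom.comp_apply, Ideal.Quotient.mkₐ_eq_mk]
      rw [Ideal.Quotient.eq]
      rcases i with i | j
      · rw [fiberHom_X_inl, map_mul, hσX, hσC, MvPolynomial.rename_C, Ideal.mem_span_singleton']
        fin_cases i
        · refine ⟨MvPolynomial.C (d 1), ?_⟩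
          simp only [hl, pointForm, Fin.zero_eta]
          linear_combination MvPolynomial.X (Sum.inl 0) * hdC
        · refine ⟨-MvPolynomial.C (d 0), ?_⟩
          simp only [hl, pointForm, Fin.mk_one]
          linear_combination MvPolynomial.X (Sum.inl 1) * hdC
      · rw [fiberHom_X_inr, hσC, MvPolynomial.rename_X, sub_self]
        exact Ideal.zero_mem _
    rw [← Ideal.Quotient.eq]
    exact DFunLike.congr_fun this F

lemma ker_fiberHom (ι : Type*) {c : Fin 2 → k} (hc : c ≠ 0) :
    RingHom.ker (fiberHom ι c) = Ideal.span {pointForm ι c} := by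
  obtain ⟨σ, -, hσ⟩ := exists_section ι hc
  refine le_antisymm (fun F hF => ?_) ?_
  · simpa [RingHom.mem_ker.1 hF] using hσ F
  · rw [Ideal.span_singleton_le_iff_mem]
    exact fiberHom_pointForm_self c

/-- The target of `fiberHom` is a domain in which the forms of the other points stay nonzero, so the
factors split off one at a time by `ker_fiberHom`. -/
lemma prod_pointForm_dvd (s : Finset (ProjSpace k 1)) {F : MvPolynomial (Fin 2 ⊕ ι) k}
    (h : ∀ P ∈ s, fiberHom ι P.rep F = 0) : ∏ P ∈ s, pointForm ι P.rep ∣ F := by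
  classical
  induction s using Finset.induction_on with
  | empty => simp
  | insert P s hP ih =>
    obtain ⟨G, rfl⟩ := ih fun Q hQ => h Q (Finset.mem_insert_of_mem hQ)
    have hF := h P (Finset.mem_insert_self _ _)
    rw [map_mul, map_prod, mul_eq_zero, Finset.prod_eq_zero_iff] at hF
    rcases hF with ⟨Q, hQ, hQ0⟩ | hG
    · refine absurd hQ0 ?_
      have hne : Q ≠ Projectivization.mk k P.rep P.rep_nonzero := by
        rw [P.mk_rep]; rintro rfl; exact hP hQ
      rw [fiberHom_pointForm]
      refine mul_ne_zero (fun h0 => det_rep_ne_zero P.rep_nonzero hne ?_) Polynomial.X_ne_zero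
      exact MvPolynomial.C_eq_zero.1 (Polynomial.C_eq_zero.1 h0)
    · have : G ∈ RingHom.ker (fiberHom ι P.rep) := hG
      rw [ker_fiberHom ι P.rep_nonzero, Ideal.mem_span_singleton] at this
      rw [Finset.prod_insert hP, mul_comm]
      exact mul_dvd_mul_left _ this

end LinearForm

/-! ### The combinatorics of `(⋆)`. -/

section Star

/-- The first coordinates of the points of `X` with second coordinate `Q`. -/
def fstFiber {α β : Type*} [DecidableEq α] [DecidableEq β] (X : Finset (α × β)) (Q : β) :
    Finset α :=
  (X.filter (·.2 = Q)).image Prod.fst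

lemma mem_fstFiber {α β : Type*} [DecidableEq α] [DecidableEq β] {X : Finset (α × β)} {Q : β}
    {P : α} : P ∈ fstFiber X Q ↔ (P, Q) ∈ X := by
  simp [fstFiber]

/-- Under `(⋆)` any two fibers are comparable. Take for `A` the largest fiber with at most `i`
points: it contains all the other fibers of size at most `i`. -/
lemma exists_card_le_forall_lt_card_fstFiber {k : Type*} [Field k] {m n : ℕ}
    [DecidableEq (ProjSpace k m)] [DecidableEq (ProjSpace k n)]
    {X : Finset (ProjSpace k m × ProjSpace k n)}
    (hX : PropertyStar (X : Set (ProjSpace k m × ProjSpace k n))) (i : ℕ) :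
    ∃ A : Finset (ProjSpace k m), A.card ≤ i ∧ A ⊆ X.image Prod.fst ∧
      ∀ p ∈ X, p.1 ∉ A → i < (fstFiber X p.2).card := by
  classical
  let S := (X.image Prod.snd).filter fun Q => (fstFiber X Q).card ≤ i
  by_cases hS : S.Nonempty
  · obtain ⟨Q, hQ, hmax⟩ := S.exists_max_image (fun Q => (fstFiber X Q).card) hS
    refine ⟨fstFiber X Q, (Finset.mem_filter.1 hQ).2, fun P hP => ?_, ?_⟩
    · exact Finset.mem_image_of_mem Prod.fst (mem_fstFiber.1 hP)
    · rintro ⟨P', Q'⟩ hp hP'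
      by_contra! hlt
      have hle := hmax Q' (Finset.mem_filter.2 ⟨Finset.mem_image_of_mem Prod.snd hp, hlt⟩)
      have hnot : ¬ fstFiber X Q ⊆ fstFiber X Q' := fun hsub =>
        hP' (by rw [Finset.eq_of_subset_of_card_le hsub hle]; exact mem_fstFiber.2 hp)
      obtain ⟨P, hP, hPQ'⟩ := Finset.not_subset.1 hnot
      rw [mem_fstFiber] at hP hPQ' hP'
      have hPP' : P ≠ P' := by rintro rfl; exact hPQ' hp
      have hQQ' : Q ≠ Q' := by rintro rfl; exact hPQ' hP
      rcases hX P P' Q Q' (Finset.mem_coe.2 hP) (Finset.mem_coe.2 hp) hPP' hQQ' with h | h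
      · exact hPQ' (Finset.mem_coe.1 h)
      · exact hP' (Finset.mem_coe.1 h)
  · refine ⟨∅, by simp, by simp, fun p hp _ => ?_⟩
    by_contra! hlt
    exact hS ⟨p.2, Finset.mem_filter.2 ⟨Finset.mem_image_of_mem Prod.snd hp, hlt⟩⟩

end Star

/-! ### The image of `I_X` modulo the form of a point off `X`. -/

section SpecialFiber

variable {k : Type*} [Field k] {n : ℕ} [DecidableEq (ProjSpace k 1)] [DecidableEq (ProjSpace k n)]
  {X : Finset (ProjSpace k 1 × ProjSpace k n)} {c : Fin 2 → k}

/-- Over the line of `Q`, `F` is divisible by one linear form for each point of the fiber, and each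
of these restricts to a multiple of `T`. -/
lemma lineHom_coeff_fiberHom_eq_zero (c : Fin 2 → k) {F : BiCoordRing k 1 n}
    (hF : F ∈ pointsIdeal (X : Set (ProjSpace k 1 × ProjSpace k n))) (Q : ProjSpace k n) {i : ℕ}
    (hi : i < (fstFiber X Q).card) : lineHom Q.rep ((fiberHom _ c F).coeff i) = 0 := by
  have hdvd : ∏ P ∈ fstFiber X Q, pointForm Unit P.rep ∣ sndLineHom 1 Q.rep F := by
    refine prod_pointForm_dvd _ fun P hP => ?_
    rw [fiberHom_sndLineHom]
    exact mem_pointsIdeal_iff.1 hF (P, Q) (Finset.mem_coe.2 (mem_fstFiber.1 hP))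
  have hX : Polynomial.X ^ (fstFiber X Q).card ∣ coneHom c Q.rep F := by
    rw [← fiberHom_sndLineHom]
    refine dvd_trans ?_ (map_dvd (fiberHom Unit c) hdvd)
    rw [map_prod]
    simp only [fiberHom_pointForm, Finset.prod_mul_distrib, Finset.prod_const]
    exact dvd_mul_left _ _
  rw [← coeff_coneHom_eq_lineHom]
  exact Polynomial.X_pow_dvd_iff.1 hX i hi

lemma exists_mem_pointsIdeal_fiberHom_eq_monomial
    (hX : PropertyStar (X : Set (ProjSpace k 1 × ProjSpace k n))) (hc : c ≠ 0)
    (hcX : ∀ p ∈ X, p.1 ≠ Projectivization.mk k c hc) {i : ℕ} {g : MvPolynomial (Fin (n + 1)) k}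
    (hg : ∀ Q : ProjSpace k n, i < (fstFiber X Q).card → lineHom Q.rep g = 0) :
    ∃ G ∈ pointsIdeal (X : Set (ProjSpace k 1 × ProjSpace k n)),
      fiberHom _ c G = Polynomial.monomial i g := by
  obtain ⟨A, hAi, hAX, hA⟩ := exists_card_le_forall_lt_card_fstFiber hX i
  obtain ⟨σ, hσ, -⟩ := exists_section (Fin (n + 1)) hc
  set u : k := ∏ P ∈ A, (P.rep 1 * c 0 - P.rep 0 * c 1) with hu
  have hu0 : u ≠ 0 := by
    refine Finset.prod_ne_zero_iff.2 fun P hP => det_rep_ne_zero hc ?_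
    obtain ⟨p, hp, rfl⟩ := Finset.mem_image.1 (hAX hP)
    exact hcX p hp
  -- The product kills the points over `A` and `g` kills the rest. The power of `σ T` raises the
  -- `T`-degree to `i`, and `u⁻¹` normalizes the coefficient.
  refine ⟨MvPolynomial.C u⁻¹ * (∏ P ∈ A, pointForm (Fin (n + 1)) P.rep) *
    σ Polynomial.X ^ (i - A.card) * MvPolynomial.rename Sum.inr g, ?_, ?_⟩
  · refine mem_pointsIdeal_iff.2 fun p hp => ?_
    rw [Finset.mem_coe] at hp
    rw [map_mul, map_mul, map_mul]
    by_cases hpA : p.1 ∈ A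
    · have : coneHom p.1.rep p.2.rep (∏ P ∈ A, pointForm (Fin (n + 1)) P.rep) = 0 := by
        rw [map_prod]
        refine Finset.prod_eq_zero hpA ?_
        rw [coneHom_apply, fiberHom_pointForm_self, Polynomial.map_zero]
      rw [this]; simp
    · have : coneHom p.1.rep p.2.rep (MvPolynomial.rename Sum.inr g) = 0 := by
        rw [coneHom_apply, fiberHom_rename_inr, Polynomial.map_C, RingHom.coe_coe,
          hg p.2 (hA p hp hpA), Polynomial.C_0]
      rw [this]; simp
  · rw [map_mul, map_mul, map_mul, fiberHom_rename_inr, map_pow, hσ, map_prod, fiberHom_C]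
    simp only [fiberHom_pointForm, Finset.prod_mul_distrib, Finset.prod_const]
    rw [← map_prod, ← map_prod, ← hu, ← mul_assoc, ← map_mul, ← map_mul, inv_mul_cancel₀ hu0,
      map_one, map_one, one_mul, ← pow_add, Nat.add_sub_cancel' hAi, mul_comm,
      Polynomial.C_mul_X_pow_eq_monomial]

lemma exists_mem_pointsIdeal_fiberHom_eq
    (hX : PropertyStar (X : Set (ProjSpace k 1 × ProjSpace k n))) (hc : c ≠ 0)
    (hcX : ∀ p ∈ X, p.1 ≠ Projectivization.mk k c hc)
    {f : Polynomial (MvPolynomial (Fin (n + 1)) k)}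
    (hf : ∀ (Q : ProjSpace k n) (i : ℕ), i < (fstFiber X Q).card →
      lineHom Q.rep (f.coeff i) = 0) :
    ∃ G ∈ pointsIdeal (X : Set (ProjSpace k 1 × ProjSpace k n)), fiberHom _ c G = f := by
  choose G hG hGf using fun i => exists_mem_pointsIdeal_fiberHom_eq_monomial hX hc hcX
    (i := i) (g := f.coeff i) fun Q hQ => hf Q i hQ
  refine ⟨∑ i ∈ f.support, G i, Ideal.sum_mem _ fun i _ => hG i, ?_⟩
  rw [map_sum, Finset.sum_congr rfl fun i _ => hGf i]
  exact f.sum_monomial_eq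

/-- A form in the second set of variables which vanishes at no point of `X` is a nonzerodivisor
modulo `I_X` and a linear form `pointForm c` vanishing at no point of `X`. -/
lemma mem_sup_of_rename_mul_mem_sup
    (hX : PropertyStar (X : Set (ProjSpace k 1 × ProjSpace k n))) (hc : c ≠ 0)
    (hcX : ∀ p ∈ X, p.1 ≠ Projectivization.mk k c hc) {h : MvPolynomial (Fin (n + 1)) k}
    (hh : ∀ p ∈ X, lineHom p.2.rep h ≠ 0) {F : BiCoordRing k 1 n}
    (hF : MvPolynomial.rename Sum.inr h * F ∈
      pointsIdeal (X : Set (ProjSpace k 1 × ProjSpace k n)) ⊔ Ideal.span {pointForm _ c}) :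
    F ∈ pointsIdeal (X : Set (ProjSpace k 1 × ProjSpace k n)) ⊔ Ideal.span {pointForm _ c} := by
  rw [← ker_fiberHom _ hc] at hF ⊢
  obtain ⟨u, hu, v, hv, huv⟩ := Submodule.mem_sup.1 hF
  have huF : fiberHom _ c u = Polynomial.C h * fiberHom _ c F := by
    rw [← fiberHom_rename_inr c, ← map_mul, ← huv, map_add, RingHom.mem_ker.1 hv, add_zero]
  obtain ⟨G, hG, hGF⟩ := exists_mem_pointsIdeal_fiberHom_eq hX hc hcX (f := fiberHom _ c F) <| by
    intro Q i hi
    -- The fiber over `Q` is nonempty, so `h` is nonzero on the line of `Q` and cancels.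
    obtain ⟨P, hP⟩ := Finset.card_pos.1 (Nat.zero_lt_of_lt hi)
    have := lineHom_coeff_fiberHom_eq_zero c hu Q hi
    rw [huF, Polynomial.coeff_C_mul, map_mul] at this
    exact (mul_eq_zero.1 this).resolve_left (hh (P, Q) (mem_fstFiber.1 hP))
  refine Submodule.mem_sup.2 ⟨G, hG, F - G, ?_, by ring⟩
  rw [RingHom.mem_ker, map_sub, hGF, sub_self]

end SpecialFiber

/-! ### Regular sequences and dimension. -/

section Regular

open scoped Pointwise

lemma supportDim_quotient_add_length_le {A : Type*} [CommRing A] {M : Type*} [AddCommGroup M]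
    [Module A M] [Module.Finite A M] (rs : List A)
    (h : RingTheory.Sequence.IsWeaklyRegular M rs) :
    Module.supportDim A (M ⧸ (Ideal.ofList rs • ⊤ : Submodule A M)) + rs.length ≤
      Module.supportDim A M := by
  induction rs generalizing M with
  | nil =>
    rw [Ideal.ofList_nil, Submodule.bot_smul]
    simpa using (Module.supportDim_eq_of_equiv (Submodule.quotEquivOfEqBot ⊥ rfl)).le
  | cons x rs ih =>
    rw [RingTheory.Sequence.isWeaklyRegular_cons_iff] at h
    rw [Module.supportDim_eq_of_equiv
      (Submodule.quotOfListConsSMulTopEquivQuotSMulTopInner M x rs), List.length_cons,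
      Nat.cast_add, Nat.cast_one, ← add_assoc]
    exact (add_le_add_left (ih h.2) 1).trans
      (Module.supportDim_quotSMulTop_succ_le_of_notMem_minimalPrimes
        fun _ => h.1.notMem_of_mem_minimalPrimes)

lemma length_le_ringKrullDim_quotient {A : Type*} [CommRing A] {I : Ideal A} {rs : List A}
    (h : RingTheory.Sequence.IsRegular (A ⧸ I) rs) :
    (rs.length : WithBot ℕ∞) ≤ ringKrullDim (A ⧸ I) := by
  have := h.quot_ofList_smul_nontrivial
  -- The quotient by a regular sequence is nontrivial, so its support has dimension at least 0
  -- rather than `⊥`.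
  have h0 := Order.krullDim_nonneg_iff.2
    (Module.nonempty_support_of_nontrivial (R := A)
      (M := (A ⧸ I) ⧸ (Ideal.ofList rs • ⊤ : Submodule A (A ⧸ I)))).to_subtype
  rw [← Module.supportDim_quotient_eq_ringKrullDim]
  refine le_trans ?_ (supportDim_quotient_add_length_le rs h.toIsWeaklyRegular)
  exact le_add_of_nonneg_left h0

lemma isSMulRegular_quotSMulTop_quotient {A : Type*} [CommRing A] {I : Ideal A} {x y : A}
    (h : ∀ z, y * z ∈ I ⊔ Ideal.span {x} → z ∈ I ⊔ Ideal.span {x}) :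
    IsSMulRegular (QuotSMulTop x (A ⧸ I)) y := by
  have key (z : A) : (Ideal.Quotient.mk I z ∈ (x • ⊤ : Submodule A (A ⧸ I))) ↔
      z ∈ I ⊔ Ideal.span {x} := by
    rw [Submodule.mem_smul_pointwise_iff_exists, Submodule.mem_sup]
    constructor
    · rintro ⟨b, -, hb⟩
      obtain ⟨b, rfl⟩ := Ideal.Quotient.mk_surjective b
      refine ⟨z - x * b, ?_, x * b, Ideal.mul_mem_right _ _ (Ideal.mem_span_singleton_self x),
        by ring⟩
      rw [← Ideal.Quotient.eq]
      exact hb.symm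
    · rintro ⟨u, hu, v, hv, rfl⟩
      obtain ⟨b, rfl⟩ := Ideal.mem_span_singleton'.1 hv
      refine ⟨Ideal.Quotient.mk I b, trivial, ?_⟩
      rw [map_add, Ideal.Quotient.eq_zero_iff_mem.2 hu, zero_add, mul_comm b]
      rfl
  refine (isSMulRegular_quotient_iff_mem_of_smul_mem _ _).2 fun z hz => ?_
  obtain ⟨z, rfl⟩ := Ideal.Quotient.mk_surjective z
  exact (key z).2 (h z ((key (y * z)).1 hz))

lemma ofList_smul_top_ne_top {A B : Type*} [CommRing A] [CommRing B] [Nontrivial B]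
    {I : Ideal A} (e : A →+* B) (hI : I ≤ RingHom.ker e) {rs : List A}
    (hrs : ∀ r ∈ rs, e r = 0) : (⊤ : Submodule A (A ⧸ I)) ≠ Ideal.ofList rs • ⊤ := by
  intro htop
  have hle : Ideal.ofList rs ≤ RingHom.ker e := Ideal.span_le.2 hrs
  have hzero : ∀ z ∈ (Ideal.ofList rs • ⊤ : Submodule A (A ⧸ I)),
      Ideal.Quotient.lift I e (fun a ha => RingHom.mem_ker.1 (hI ha)) z = 0 := by
    intro z hz
    induction hz using Submodule.smul_induction_on' with
    | smul r hr z _ =>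
      rw [Algebra.smul_def, map_mul, Ideal.Quotient.algebraMap_eq, Ideal.Quotient.lift_mk,
        RingHom.mem_ker.1 (hle hr), zero_mul]
    | add x _ y _ hx hy => rw [map_add, hx, hy, add_zero]
  have := hzero 1 (htop ▸ Submodule.mem_top)
  rw [map_one] at this
  exact one_ne_zero this

end Regular

/-! ### The upper bound on the dimension. -/

section Dimension

variable {k : Type*} [Field k] {m n : ℕ}

lemma coneHom_surjective {a : Fin (m + 1) → k} {b : Fin (n + 1) → k} (ha : a ≠ 0) (hb : b ≠ 0) :
    Function.Surjective (coneHom a b) := by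
  obtain ⟨i, hi⟩ := Function.ne_iff.1 ha
  obtain ⟨j, hj⟩ := Function.ne_iff.1 hb
  rw [← AlgHom.range_eq_top, eq_top_iff]
  have hX : Polynomial.X ∈ (coneHom a b).range := by
    refine ⟨MvPolynomial.C (a i)⁻¹ * MvPolynomial.X (Sum.inl i), ?_⟩
    simp only [AlgHom.toRingHom_eq_coe, RingHom.coe_coe, coneHom_apply, map_mul, fiberHom_C,
      fiberHom_X_inl, Polynomial.map_mul, Polynomial.map_C, Polynomial.map_X, lineHom_C]
    rw [← mul_assoc, ← map_mul, ← map_mul, inv_mul_cancel₀ hi, map_one, map_one, one_mul]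
  have hC (g : MvPolynomial Unit k) : Polynomial.C g ∈ (coneHom a b).range := by
    induction g using MvPolynomial.induction_on with
    | C r => exact (coneHom a b).range.algebraMap_mem r
    | add p q hp hq => rw [map_add]; exact add_mem hp hq
    | mul_X p u hp =>
      rw [map_mul]
      refine mul_mem hp ⟨MvPolynomial.C (b j)⁻¹ * MvPolynomial.X (Sum.inr j), ?_⟩
      simp only [AlgHom.toRingHom_eq_coe, RingHom.coe_coe, coneHom_apply, map_mul, fiberHom_C,
        fiberHom_X_inr, Polynomial.map_C, lineHom_C, lineHom_X]
      rw [← mul_assoc, ← Polynomial.C_mul, ← MvPolynomial.C_mul, inv_mul_cancel₀ hj, map_one,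
        map_one, one_mul]
  intro f _
  induction f using Polynomial.induction_on' with
  | add p q hp hq => exact add_mem (hp trivial) (hq trivial)
  | monomial d g =>
    rw [← Polynomial.C_mul_X_pow_eq_monomial]
    exact mul_mem (hC g) (pow_mem hX d)

lemma ringKrullDim_quotient_ker_coneHom {a : Fin (m + 1) → k} {b : Fin (n + 1) → k}
    (ha : a ≠ 0) (hb : b ≠ 0) :
    ringKrullDim (BiCoordRing k m n ⧸ RingHom.ker (coneHom a b)) = 2 := by
  have e : (BiCoordRing k m n ⧸ RingHom.ker (coneHom a b)) ≃+* Polynomial (MvPolynomial Unit k) :=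
    (Ideal.quotientKerAlgEquivOfSurjective (coneHom_surjective ha hb)).toRingEquiv
  rw [ringKrullDim_eq_of_ringEquiv e, Polynomial.ringKrullDim_of_isNoetherianRing,
    MvPolynomial.ringKrullDim_of_isNoetherianRing, ringKrullDim_eq_zero_of_field]
  simp only [Nat.card_unique]
  rfl

/-- The smallest prime of a chain over `I` contains some `J i`, hence so does the whole chain. -/
lemma ringKrullDim_quotient_le_of_iInf_le {A ι : Type*} [CommRing A] {I : Ideal A}
    (s : Finset ι) (J : ι → Ideal A) (hI : s.inf J ≤ I) {d : WithBot ℕ∞}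
    (hJ : ∀ i ∈ s, ringKrullDim (A ⧸ J i) ≤ d) : ringKrullDim (A ⧸ I) ≤ d := by
  rw [ringKrullDim_quotient]
  refine iSup_le fun p => ?_
  obtain ⟨i, hi, hle⟩ := (Ideal.IsPrime.inf_le' p.head.1.2).1 (hI.trans p.head.2)
  refine le_trans ?_ (hJ i hi)
  rw [ringKrullDim_quotient]
  let q : LTSeries (PrimeSpectrum.zeroLocus (J i : Set A)) :=
    { length := p.length
      toFun := fun j => ⟨(p j).1, hle.trans (p.monotone (Fin.zero_le j))⟩
      step := fun j => p.step j }
  exact le_iSup (fun q : LTSeries (PrimeSpectrum.zeroLocus (J i : Set A)) =>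
    (q.length : WithBot ℕ∞)) q

lemma ringKrullDim_quotient_pointsIdeal_le {X : Set (ProjSpace k m × ProjSpace k n)}
    (hX : X.Finite) : ringKrullDim (BiCoordRing k m n ⧸ pointsIdeal X) ≤ 2 := by
  refine ringKrullDim_quotient_le_of_iInf_le hX.toFinset
    (fun p => RingHom.ker (coneHom (k := k) p.1.rep p.2.rep)) (fun F hF => ?_)
    fun p _ => (ringKrullDim_quotient_ker_coneHom p.1.rep_nonzero p.2.rep_nonzero).le
  refine mem_pointsIdeal_iff.2 fun p hp => ?_
  exact (Finset.inf_le (f := fun p : ProjSpace k m × ProjSpace k n =>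
    RingHom.ker (coneHom (k := k) p.1.rep p.2.rep)) (hX.mem_toFinset.2 hp)) hF

end Dimension

/-! ### Forms and points avoiding a finite set. -/

section LinearForms

variable {k : Type*} [Field k] {m n : ℕ}

lemma exists_lineHom_ne_zero [Infinite k] (Y : Finset (ProjSpace k n)) :
    ∃ η : Fin (n + 1) → k, ∀ Q ∈ Y,
      lineHom Q.rep (∑ j, MvPolynomial.C (η j) * MvPolynomial.X j) ≠ 0 := by
  obtain ⟨f, hf⟩ := Module.exists_dual_forall_apply_ne_zero (K := k)
    (fun Q : Y => Q.1.rep) fun Q => Q.1.rep_nonzero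
  refine ⟨fun j => f (Pi.single j 1), fun Q hQ h0 => hf ⟨Q, hQ⟩ ?_⟩
  simp only [map_sum, map_mul, lineHom_C, lineHom_X, ← mul_assoc] at h0
  rw [← Finset.sum_mul] at h0
  have h1 := (mul_eq_zero.1 h0).resolve_right (MvPolynomial.X_ne_zero ())
  simp only [← map_mul, ← map_sum] at h1
  rw [MvPolynomial.C_eq_zero] at h1
  refine ((LinearMap.pi_apply_eq_sum_univ f Q.rep).trans
    (Finset.sum_congr rfl fun j _ => ?_)).trans h1
  rw [smul_eq_mul, mul_comm]
  congr 2
  ext i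
  simp [Pi.single_apply, eq_comm]

lemma exists_forall_ne_mk [Infinite k] (Y : Finset (ProjSpace k 1)) :
    ∃ (c : Fin 2 → k) (hc : c ≠ 0), ∀ P ∈ Y, P ≠ Projectivization.mk k c hc := by
  obtain ⟨f, hf⟩ := Module.exists_dual_forall_apply_ne_zero (K := k)
    (fun o : Option Y => o.elim ![1, 0] fun P => P.1.rep) (by
      rintro (_ | P)
      · exact fun h => one_ne_zero (congrFun h 0)
      · exact P.1.rep_nonzero)
  have hf0 : f ![1, 0] ≠ 0 := hf none
  -- This vector lies in the kernel of `f`, which contains no representative of a point of `Y`.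
  -- Including `![1, 0]` among the vectors avoided by `f` makes it nonzero.
  refine ⟨![-f ![0, 1], f ![1, 0]], fun h => hf0 (congrFun h 1), fun P hP h => ?_⟩
  have hfP : f P.rep = P.rep 0 * f ![1, 0] + P.rep 1 * f ![0, 1] := by
    rw [← smul_eq_mul, ← smul_eq_mul, ← map_smul, ← map_smul, ← map_add]
    congr 1
    ext i; fin_cases i <;> simp
  rw [← P.mk_rep, Projectivization.mk_eq_mk_iff'] at h
  obtain ⟨u, hu⟩ := h
  refine hf (some ⟨P, hP⟩) (hfP.trans ?_)
  rw [← hu]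
  simp
  ring

end LinearForms

/-! ### The regular sequence and the theorem. -/

section Main

variable {k : Type*} [Field k] {n : ℕ}

lemma exists_isRegular_pair [Infinite k] {X : Set (ProjSpace k 1 × ProjSpace k n)}
    (hfin : X.Finite) (hne : X.Nonempty) (hX : PropertyStar X) :
    ∃ x y : BiCoordRing k 1 n, x ∈ irrelevantIdeal k 1 n ∧ y ∈ irrelevantIdeal k 1 n ∧
      RingTheory.Sequence.IsRegular (BiCoordRing k 1 n ⧸ pointsIdeal X) [x, y] := by
  classical
  lift X to Finset (ProjSpace k 1 × ProjSpace k n) using hfin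
  obtain ⟨c, hc, hcX⟩ := exists_forall_ne_mk (X.image Prod.fst)
  obtain ⟨η, hη⟩ := exists_lineHom_ne_zero (X.image Prod.snd)
  have hvar (i) : MvPolynomial.X i ∈ irrelevantIdeal k 1 n := Ideal.subset_span ⟨i, rfl⟩
  have hx : pointForm (Fin (n + 1)) c ∈ irrelevantIdeal k 1 n :=
    Ideal.sub_mem _ (Ideal.mul_mem_left _ _ (hvar _)) (Ideal.mul_mem_left _ _ (hvar _))
  have hy : MvPolynomial.rename Sum.inr (∑ j, MvPolynomial.C (η j) * MvPolynomial.X j) ∈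
      irrelevantIdeal k 1 n := by
    simp only [map_sum, map_mul, MvPolynomial.rename_X]
    exact Ideal.sum_mem _ fun j _ => Ideal.mul_mem_left _ _ (hvar _)
  refine ⟨_, _, hx, hy, ?_⟩
  rw [RingTheory.Sequence.isRegular_iff]
  refine ⟨.cons ?_ (.cons ?_ (.nil _ _)), ?_⟩
  · refine (isSMulRegular_quotient_iff_mem_of_smul_mem _ _).2 fun F hF => ?_
    refine mem_pointsIdeal_iff.2 fun p hp => ?_
    have hpF := mem_pointsIdeal_iff.1 hF p hp
    rw [smul_eq_mul, map_mul, mul_eq_zero, coneHom_apply, fiberHom_pointForm] at hpF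
    refine hpF.resolve_left ?_
    rw [Polynomial.map_mul, Polynomial.map_C, Polynomial.map_X, RingHom.coe_coe, lineHom_C]
    refine mul_ne_zero (fun h0 => ?_) Polynomial.X_ne_zero
    have h1 := MvPolynomial.C_eq_zero.1 (Polynomial.C_eq_zero.1 h0)
    refine det_rep_ne_zero hc (hcX p.1 (Finset.mem_image_of_mem _ hp)) ?_
    linear_combination -h1
  · exact isSMulRegular_quotSMulTop_quotient fun F => mem_sup_of_rename_mul_mem_sup hX hc
      (fun p hp => hcX p.1 (Finset.mem_image_of_mem _ hp))
      fun p hp => hη p.2 (Finset.mem_image_of_mem _ hp)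
  · have hirr : irrelevantIdeal k 1 n ≤
        RingHom.ker (MvPolynomial.constantCoeff : BiCoordRing k 1 n →+* k) := by
      refine Ideal.span_le.2 ?_
      rintro _ ⟨i, rfl⟩
      exact MvPolynomial.constantCoeff_X k i
    refine ofList_smul_top_ne_top (MvPolynomial.constantCoeff : BiCoordRing k 1 n →+* k) ?_ ?_
    · intro F hF
      obtain ⟨p, hp⟩ := hne
      -- Scaling both lines by 0 leaves only the constant term of `F`, so it must vanish.
      have h0 := (coneHom_smul_smul_eq_zero _ _ 0 0 (mem_pointsIdeal_iff.1 hF p hp))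
      have h1 : coneHom (0 : Fin 2 → k) (0 : Fin (n + 1) → k) =
          (Algebra.ofId k _).comp (MvPolynomial.aeval (0 : Fin 2 ⊕ Fin (n + 1) → k)) := by
        refine MvPolynomial.algHom_ext fun i => ?_
        rcases i with i | j <;> simp [coneHom]
      rw [zero_smul, zero_smul, h1, AlgHom.comp_apply, MvPolynomial.aeval_zero] at h0
      exact (Algebra.ofId k (Polynomial (MvPolynomial Unit k))).toRingHom.injective
        (by simpa using h0)
    · intro r hr
      simp only [List.mem_cons, List.not_mem_nil, or_false] at hr
      rcases hr with rfl | rfl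
      · exact hirr hx
      · exact hirr hy

end Main

theorem theorem4p5 (k : Type*) [Field k] [IsAlgClosed k] [CharZero k] (n : ℕ)
    (X : Set (ProjSpace k 1 × ProjSpace k n)) (hfin : X.Finite) (hne : X.Nonempty)
    (hstar : PropertyStar X) : IsACM X := by
  obtain ⟨x, y, hx, hy, hreg⟩ := exists_isRegular_pair hfin hne hstar
  have hdim : ringKrullDim (BiCoordRing k 1 n ⧸ pointsIdeal X) = 2 :=
    le_antisymm (ringKrullDim_quotient_pointsIdeal_le hfin) (length_le_ringKrullDim_quotient hreg)
  refine ⟨hdim, le_antisymm (iSup₂_le fun rs hrs => ?_) ?_⟩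
  · have := length_le_ringKrullDim_quotient hrs.2
    rw [hdim] at this
    exact_mod_cast this
  · refine le_iSup₂_of_le [x, y] ⟨?_, hreg⟩ le_rfl
    simp [hx, hy]
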